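/- Let $\sigma\ge 2$ be an integer and let $c,\epsilon$ be real constants with $1-\epsilon>c>\epsilon>0$. For a string $s$ of length $n$ over an alphabet of size $\sigma$, let $H_0(s)=\frac1n\sum_{a}n_a\log_2\frac{n}{n_a}$, where $a$ ranges over the characters that occur in $s$ and $n_a$ is the number of occurrences of $a$, and for $k\ge1$ let $H_k(s)=\frac1n\sum_{|w|=k}|w_s|\,H_0(w_s)$, where $w_s$ is the concatenation of the characters that immediately follow the occurrences of $w$ in $s$. In the Multipass model, the input is stored on a read-only tape, which the algorithm reads from left to right and rewinds completely whenever it reaches the end; it has a bounded memory and appends bits to an output stream, which is the stored encoding. In the W-Streams model the algorithm may, in addition, replace the contents of the tape during each pass by a new string over a tape alphabet of constant size that contains the input alphabet (even one of arbitrary length, so in particular one longer by at most a constant factor); the stored encoding consists of the output stream, or of the contents of the tape after the last pass, or of both. In both models the algorithm may depend on $n$, and it is a correct compression algorithm only if, for each $n$, distinct strings of length $n$ have distinct encodings. Consider any such algorithm, in either model, that on inputs of length $n$ uses $O(n^c)$ bits of memory and makes $\log^{O(1)}n$ passes. Let $k=\lceil(c+\epsilon/2)\log_\sigma n\rceil$.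 Then it does not store every string $s$ of length $n$ in $O\left(nH_k(s)+\sigma^k n^{1-c-\epsilon}\right)$ bits. In fact, for every constant $C$ and every sufficiently large $n$ there is a string $s$ of length $n$ whose encoding has more than $C\left(nH_k(s)+\sigma^k n^{1-c-\epsilon}\right)$ bits. -/

import Mathlib

open Filter Asymptotics

/-! ### Empirical entropy -/

/-- The characters that immediately follow the (possibly overlapping) occurrences of `w` in `s`,
in order of occurrence. For `w = []` this is `s` itself. -/
def followers {α : Type*} [DecidableEq α] (s w : List α) : List α :=
  (List.range s.length).filterMap fun i =>
    if (s.drop i).take w.length = w then s[i + w.length]? else none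

/-- The 0th-order empirical entropy `(1/n) ∑ n_a log₂ (n / n_a)` of a string, the sum being over
the characters `a` that occur in it. -/
noncomputable def entropy₀ {α : Type*} [DecidableEq α] (s : List α) : ℝ :=
  (1 / (s.length : ℝ)) * ∑ a ∈ s.toFinset,
    (s.count a : ℝ) * Real.logb 2 ((s.length : ℝ) / (s.count a : ℝ))

/-- The `k`th-order empirical entropy `(1/n) ∑_{|w| = k} |w_s| H₀(w_s)`. -/
noncomputable def entropy {α : Type*} [DecidableEq α] [Fintype α] (k : ℕ) (s : List α) : ℝ :=
  (1 / (s.length : ℝ)) * ∑ w : Fin k → α,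
    ((followers s (List.ofFn w)).length : ℝ) * entropy₀ (followers s (List.ofFn w))

/-! ### The W-Streams model -/

/-- What an algorithm does in one step: its new memory contents (a string of bits), the symbols it
writes at the end of the new tape, and the bits it appends to its output stream. -/
structure StreamAction (Γ : Type) where
  mem : List Bool
  tape : List Γ
  out : List Bool

/-- A W-Streams algorithm for inputs over `{0, …, σ - 1}` with tape alphabet `Γ`. The only
information it keeps from one step to the next is its memory contents; in particular it does not
know the position of its head or the number of the current pass unless it has them in memory. -/
structure WStreamsAlg (σ : ℕ) (Γ : Type) where
  /-- The input characters as tape symbols. -/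
  input : Fin σ ↪ Γ
  /-- The initial memory contents. -/
  start : List Bool
  /-- The action on reading a tape symbol. -/
  step : List Bool → Γ → StreamAction Γ
  /-- The action on reaching the end of the tape. -/
  finish : List Bool → StreamAction Γ
  /-- Whether it stops (rather than starts another pass) on reaching the end of the tape. -/
  halts : List Bool → Bool

/-- A configuration between two passes: memory contents, tape contents, all bits output so far,
and whether the algorithm has stopped. -/
structure StreamConfig (Γ : Type) where
  mem : List Bool
  tape : List Γ
  out : List Bool
  halted : Bool

namespace WStreamsAlg

variable {σ : ℕ} {Γ : Type}

/-- The total effect of reading the symbols of a string from left to right, starting with memory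
contents `m`. -/
def scan (A : WStreamsAlg σ Γ) (m : List Bool) : List Γ → StreamAction Γ
  | [] => ⟨m, [], []⟩
  | a :: t =>
    let x := A.step m a
    let y := A.scan x.mem t
    ⟨y.mem, x.tape ++ y.tape, x.out ++ y.out⟩

/-- One pass: the whole tape is read from left to right, and is then replaced by what was written
during the pass. Nothing happens once the algorithm has stopped. -/
def pass (A : WStreamsAlg σ Γ) (C : StreamConfig Γ) : StreamConfig Γ :=
  if C.halted then C
  else
    let x := A.scan C.mem C.tape
    let y := A.finish x.mem
    ⟨y.mem, x.tape ++ y.tape, C.out ++ (x.out ++ y.out), A.halts x.mem⟩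

/-- The configuration on input `s` after `i` passes (or after the last pass, if the algorithm stops
earlier). -/
def after (A : WStreamsAlg σ Γ) (s : List (Fin σ)) (i : ℕ) : StreamConfig Γ :=
  A.pass^[i] ⟨A.start, s.map A.input, [], false⟩

/-- On input `s` the algorithm stops after at most `p` passes. -/
def HaltsWithin (A : WStreamsAlg σ Γ) (s : List (Fin σ)) (p : ℕ) : Prop :=
  (A.after s p).halted = true

/-- On input `s` the memory never holds more than `b` bits: the bound is on the memory contents
after every prefix of the tape read during every pass. -/
def UsesMemory (A : WStreamsAlg σ Γ) (s : List (Fin σ)) (b : ℕ) : Prop :=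
  ∀ i : ℕ, (A.after s i).halted = false →
    ∀ t : List Γ, t <+: (A.after s i).tape →
      (A.scan (A.after s i).mem t).mem.length ≤ b

end WStreamsAlg

/-- What counts as the stored encoding after the last pass: the output stream, the contents of the
tape, or the two together. -/
inductive Readout
  | output
  | tape
  | both

/-- The stored encoding in a final configuration. -/
def Readout.encoding {Γ : Type} : Readout → StreamConfig Γ → List Bool × List Γ
  | .output, C => (C.out, [])
  | .tape, C => ([], C.tape)
  | .both, C => (C.out, C.tape)

/-- The number of bits of a stored encoding; a tape symbol counts for `log₂ |Γ|` bits. -/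
noncomputable def encodingBits {Γ : Type} [Fintype Γ] (x : List Bool × List Γ) : ℝ :=
  (x.1.length : ℝ) + (x.2.length : ℝ) * Real.logb 2 (Fintype.card Γ : ℝ)

/-! ### The Multipass model -/

/-- A Multipass algorithm: in each pass it reads the read-only input tape from left to right, and
at the end it either stops or rewinds the tape completely. On each step it produces its new memory
contents and the bits that it appends to its output stream. -/
structure MultipassAlg (σ : ℕ) where
  start : List Bool
  step : List Bool → Fin σ → List Bool × List Bool
  finish : List Bool → List Bool × List Bool
  halts : List Bool → Bool

/-- A Multipass algorithm seen as the W-Streams algorithm that leaves every tape symbol as it is. -/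
def MultipassAlg.toWStreams {σ : ℕ} (A : MultipassAlg σ) : WStreamsAlg σ (Fin σ) where
  input := Function.Embedding.refl _
  start := A.start
  step m a := ⟨(A.step m a).1, [a], (A.step m a).2⟩
  finish m := ⟨(A.finish m).1, [], (A.finish m).2⟩
  halts := A.halts

/-- The tape of a Multipass algorithm contains the input at all times. -/
theorem MultipassAlg.tape_after {σ : ℕ} (A : MultipassAlg σ) (s : List (Fin σ)) (i : ℕ) :
    (A.toWStreams.after s i).tape = s := by
  have hscan : ∀ (t : List (Fin σ)) (m : List Bool), (A.toWStreams.scan m t).tape = t := by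
    intro t
    induction t with
    | nil => intro m; rfl
    | cons a t ih => intro m; exact congrArg (a :: ·) (ih (A.step m a).1)
  induction i with
  | zero => exact List.map_id s
  | succ i ih =>
    unfold WStreamsAlg.after at ih ⊢
    rw [Function.iterate_succ_apply', WStreamsAlg.pass]
    split
    · exact ih
    · simp only [hscan, ih]
      simp [MultipassAlg.toWStreams]

/-! Take an input that repeats a period `r` of length `ℓ ≈ n^(c+δ)`, where `δ = ε/4`, against
contexts of length `k ≈ (c+2δ) log_σ n`. For at least half of all `r`, at most about `ℓ²/σ^k ≈ n^c`
pairs of cyclic positions share a `k`-window (`card_few_collisions`). A context met at only one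
position modulo `ℓ` has constant followers, so such inputs have `n H_k` of order at most `n^(1-δ)
log n` (`mul_entropy_periodicString_le`), and the second term of the target is of order `n^(1-2δ)`.

An algorithm with a small memory cannot exploit the repetition. Suppose all these inputs had
encodings of at most `n^(1-δ/2)` bits. Then one of the `n/ℓ` copies of `r` accounts for only `O(ℓ
n^(-δ/2))` stored bits. The index of that copy, the memory contents on entering and leaving it in
each pass, and the stored data it produces determine `r`: if `r'` had the same data, substituting
`r'` for that one copy would leave the encoding unchanged (`iterate_pass_replace`), contradicting
injectivity. But such data takes only `O(n^(c+3δ/4))` bits, too few to distinguish half of the `σ^ℓ`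
periods (`card_le_of_encodingBits_le`, `exponent_le`). -/

/-! ### Following one part of the tape through all passes -/

/-- The trace of one part of the tape through several passes: the memory contents at its end and
the bits output while reading it, pass by pass, and what has become of it after the last pass. -/
structure PassTrace (Γ : Type) where
  mems : List (List Bool)
  outs : List (List Bool)
  tape : List Γ

namespace WStreamsAlg

variable {σ : ℕ} {Γ : Type}

theorem scan_append (A : WStreamsAlg σ Γ) (m : List Bool) (X Y : List Γ) :
    A.scan m (X ++ Y) = ⟨(A.scan (A.scan m X).mem Y).mem,
      (A.scan m X).tape ++ (A.scan (A.scan m X).mem Y).tape,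
      (A.scan m X).out ++ (A.scan (A.scan m X).mem Y).out⟩ := by
  induction X generalizing m with
  | nil => simp [scan]
  | cons a X ih => simp [scan, ih]

/-- The trace of the part `Y` of the tape, given the memory contents with which the algorithm
arrives at it in each pass. -/
def trace (A : WStreamsAlg σ Γ) : List (List Bool) → List Γ → PassTrace Γ
  | [], Y => ⟨[], [], Y⟩
  | m :: ms, Y =>
    let x := A.scan m Y
    let T := A.trace ms x.tape
    ⟨x.mem :: T.mems, x.out :: T.outs, T.tape⟩

theorem trace_mems_length (A : WStreamsAlg σ Γ) (ms : List (List Bool)) (Y : List Γ) :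
    (A.trace ms Y).mems.length = ms.length := by
  induction ms generalizing Y with
  | nil => rfl
  | cons m ms ih => simp [trace, ih]

theorem trace_outs_length (A : WStreamsAlg σ Γ) (ms : List (List Bool)) (Y : List Γ) :
    (A.trace ms Y).outs.length = ms.length := by
  induction ms generalizing Y with
  | nil => rfl
  | cons m ms ih => simp [trace, ih]

/-- The memory contents on leaving `X` are those on entering `Y`, pass by pass; outputs are
therefore joined within each pass. -/
theorem trace_append (A : WStreamsAlg σ Γ) (ms : List (List Bool)) (X Y : List Γ) :
    A.trace ms (X ++ Y) = ⟨(A.trace (A.trace ms X).mems Y).mems,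
      List.zipWith (· ++ ·) (A.trace ms X).outs (A.trace (A.trace ms X).mems Y).outs,
      (A.trace ms X).tape ++ (A.trace (A.trace ms X).mems Y).tape⟩ := by
  induction ms generalizing X Y with
  | nil => simp [trace]
  | cons m ms ih => simp [trace, scan_append, ih]

/-- The memory contents at the start of each of the next `p` passes (fewer if the algorithm
stops earlier). -/
def startMems (A : WStreamsAlg σ Γ) : ℕ → StreamConfig Γ → List (List Bool)
  | 0, _ => []
  | p + 1, C => if C.halted then [] else C.mem :: A.startMems p (A.pass C)

theorem startMems_length_le (A : WStreamsAlg σ Γ) (p : ℕ) (C : StreamConfig Γ) :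
    (A.startMems p C).length ≤ p := by
  induction p generalizing C with
  | zero => simp [startMems]
  | succ p ih =>
    unfold startMems
    split
    · simp
    · simpa using ih _

theorem iterate_pass_of_halted (A : WStreamsAlg σ Γ) (p : ℕ) (C : StreamConfig Γ)
    (h : C.halted = true) : A.pass^[p] C = C :=
  Function.iterate_fixed (by simp [pass, h]) p

/-- Replacing a part of the tape by another one that takes the algorithm through the same memory
contents changes the output and the final tape only where the traces of the two parts differ. -/
theorem iterate_pass_replace (A : WStreamsAlg σ Γ) (p : ℕ) (m : List Bool) (X Y Y' Z : List Γ)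
    (o o' : List Bool) (h : Bool) :
    let C : StreamConfig Γ := ⟨m, X ++ Y ++ Z, o, h⟩
    let C' : StreamConfig Γ := ⟨m, X ++ Y' ++ Z, o', h⟩
    let ms := (A.trace (A.startMems p C) X).mems
    (A.trace ms Y).mems = (A.trace ms Y').mems →
      (o = o' → (A.trace ms Y).outs = (A.trace ms Y').outs →
        (A.pass^[p] C).out = (A.pass^[p] C').out) ∧
      ((A.trace ms Y).tape = (A.trace ms Y').tape →
        (A.pass^[p] C).tape = (A.pass^[p] C').tape) := by
  induction p generalizing m X Y Y' Z o o' h with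
  | zero =>
    intro C C' ms _
    refine ⟨fun ho _ => ho, fun ht => ?_⟩
    simp only [ms, startMems, trace] at ht
    simp [C, C', ht]
  | succ p ih =>
    intro C C' ms hms
    cases h with
    | true =>
      rw [iterate_pass_of_halted A _ C rfl, iterate_pass_of_halted A _ C' rfl]
      refine ⟨fun ho _ => ho, fun ht => ?_⟩
      simp only [ms, startMems, C, trace, if_true] at ht
      simp [C, C', ht]
    | false =>
      set x := A.scan m X with hx
      set y := A.scan x.mem Y with hy
      set y' := A.scan x.mem Y' with hy'
      set z := A.scan y.mem Z with hz
      have hC : A.pass C = ⟨(A.finish z.mem).mem, x.tape ++ y.tape ++ (z.tape ++ (A.finish z.mem).tape),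
          o ++ (x.out ++ y.out ++ z.out ++ (A.finish z.mem).out), A.halts z.mem⟩ := by
        simp [pass, C, scan_append, hz, hy, hx]
      have hms' : ms = x.mem :: (A.trace (A.startMems p (A.pass C)) x.tape).mems := by
        simp [ms, startMems, C, trace, hx]
      rw [hms'] at hms ⊢
      simp only [trace, List.cons.injEq] at hms ⊢
      obtain ⟨hm, hms⟩ := hms
      -- Both parts are left with the same memory, so `Z` and the end of the pass are processed
      -- identically; the new tapes again differ only in the middle part.
      have hC' : A.pass C' = ⟨(A.finish z.mem).mem, x.tape ++ y'.tape ++ (z.tape ++ (A.finish z.mem).tape),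
          o' ++ (x.out ++ y'.out ++ z.out ++ (A.finish z.mem).out), A.halts z.mem⟩ := by
        have hm' := hm.symm
        simp only [hx] at hm'
        simp [pass, C', scan_append, hz, hy, hx, hm', hy']
      rw [Function.iterate_succ_apply, Function.iterate_succ_apply, hC']
      rw [hC] at hms ⊢
      -- The two output streams are carried separately, so equality of the tapes needs no equality
      -- of the outputs.
      have key := ih _ _ _ _ _ (o ++ (x.out ++ y.out ++ z.out ++ (A.finish z.mem).out))
        (o' ++ (x.out ++ y'.out ++ z.out ++ (A.finish z.mem).out)) _ hms
      refine ⟨fun ho hos => key.1 ?_ hos.2, key.2⟩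
      rw [ho, show y.out = y'.out from hos.1]

/-- What has become of `U` is always a prefix of the current tape, so the memory bound on prefixes
applies in every pass. -/
theorem length_le_of_mem_trace_mems (A : WStreamsAlg σ Γ) (b p : ℕ) (C : StreamConfig Γ)
    (U V : List Γ) (hC : C.tape = U ++ V)
    (hb : ∀ i : ℕ, (A.pass^[i] C).halted = false → ∀ t, t <+: (A.pass^[i] C).tape →
      (A.scan (A.pass^[i] C).mem t).mem.length ≤ b) :
    ∀ x ∈ (A.trace (A.startMems p C) U).mems, x.length ≤ b := by
  induction p generalizing C U V with
  | zero => simp [startMems, trace]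
  | succ p ih =>
    unfold startMems
    split
    · simp [trace]
    · rename_i hh
      simp only [trace, List.mem_cons, forall_eq_or_imp]
      refine ⟨hb 0 (by simpa using hh) U ⟨V, by simp [hC]⟩, ?_⟩
      refine ih (A.pass C) _ ((A.scan (A.scan C.mem U).mem V).tape ++
        (A.finish (A.scan C.mem C.tape).mem).tape) ?_ fun i => ?_
      · simp [pass, hh, hC, scan_append]
      · simpa only [Function.iterate_succ_apply] using hb (i + 1)

theorem trace_cost_le (A : WStreamsAlg σ Γ) (p : ℕ) (C : StreamConfig Γ) (U V : List Γ)
    (hC : C.tape = U ++ V) :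
    C.out.length + ((A.trace (A.startMems p C) U).outs.map List.length).sum ≤
        (A.pass^[p] C).out.length ∧
      (A.trace (A.startMems p C) U).tape.length ≤ (A.pass^[p] C).tape.length := by
  induction p generalizing C U V with
  | zero => simp [startMems, trace, hC]
  | succ p ih =>
    by_cases hh : C.halted = true
    · rw [iterate_pass_of_halted A _ C hh]
      simp [startMems, trace, hC, hh]
    · have := ih (A.pass C) (A.scan C.mem U).tape ((A.scan (A.scan C.mem U).mem V).tape ++
        (A.finish (A.scan C.mem C.tape).mem).tape) (by simp [pass, hh, hC, scan_append])
      rw [Function.iterate_succ_apply]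
      refine ⟨le_trans ?_ this.1, ?_⟩
      · simp [startMems, trace, hh, pass, scan_append, hC]
        omega
      · simpa [startMems, trace, hh] using this.2

theorem sum_length_zipWith_append (l l' : List (List Bool)) (h : l.length = l'.length) :
    ((List.zipWith (· ++ ·) l l').map List.length).sum =
      (l.map List.length).sum + (l'.map List.length).sum := by
  induction l generalizing l' with
  | nil => cases l' with
    | nil => rfl
    | cons => simp at h
  | cons a l ih => cases l' with
    | nil => simp at h
    | cons a' l' =>
      have := ih l' (by simpa using h)
      simp at this ⊢
      omega

/-- Among `m` consecutive parts of the tape there is one with at most average cost. -/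
theorem exists_trace_cost_le (A : WStreamsAlg σ Γ) (ms : List (List Bool)) (U : ℕ → List Γ)
    (Y : List Γ) (hU : ∀ i, U (i + 1) = U i ++ Y) (α β : ℝ) (hα : 0 ≤ α) (hβ : 0 ≤ β)
    (m : ℕ) (hm : 0 < m) :
    let cost : PassTrace Γ → ℝ := fun T =>
      α * ((T.outs.map List.length).sum : ℕ) + β * (T.tape.length : ℝ)
    ∃ i < m, m * cost (A.trace (A.trace ms (U i)).mems Y) ≤ cost (A.trace ms (U m)) := by
  intro cost
  -- Cost is additive under `trace_append`; only an inequality results, because the nonnegative cost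
  -- of `U 0` is dropped.
  have hsum : ∀ m : ℕ, ∑ i ∈ Finset.range m, cost (A.trace (A.trace ms (U i)).mems Y) ≤
      cost (A.trace ms (U m)) := by
    intro m
    induction m with
    | zero => simp only [Finset.range_zero, Finset.sum_empty, cost]; positivity
    | succ m ih =>
      rw [Finset.sum_range_succ, hU, trace_append]
      refine (add_le_add_left ih _).trans (le_of_eq ?_)
      simp only [cost]
      rw [sum_length_zipWith_append _ _ (by simp [trace_outs_length, trace_mems_length])]
      simp
      ring
  by_contra! hcon
  have h1 : ∑ i ∈ Finset.range m, cost (A.trace ms (U m)) <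
      ∑ i ∈ Finset.range m, m * cost (A.trace (A.trace ms (U i)).mems Y) :=
    Finset.sum_lt_sum_of_nonempty ⟨0, by simpa using hm⟩ fun i hi => hcon i (by simpa using hi)
  rw [← Finset.mul_sum, Finset.sum_const, Finset.card_range, nsmul_eq_mul] at h1
  exact absurd (mul_le_mul_of_nonneg_left (hsum m) (Nat.cast_nonneg m)) (not_le.mpr h1)

end WStreamsAlg

/-! ### Counting -/

/-- Each of `p` places holds an element of `S` or an end marker. -/
theorem exists_finset_lists {α : Type*} (S : Finset α) (p : ℕ) :
    ∃ T : Finset (List α), T.card ≤ (S.card + 1) ^ p ∧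
      ∀ l : List α, l.length ≤ p → (∀ x ∈ l, x ∈ S) → l ∈ T := by
  classical
  induction p with
  | zero =>
    refine ⟨{[]}, by simp, fun l hl _ => ?_⟩
    simpa using hl
  | succ p ih =>
    obtain ⟨T, hT, hmem⟩ := ih
    refine ⟨insert [] ((S ×ˢ T).image fun x => x.1 :: x.2), ?_, fun l hl hS => ?_⟩
    · calc _ ≤ ((S ×ˢ T).image fun x => x.1 :: x.2).card + 1 := Finset.card_insert_le _ _
        _ ≤ (S ×ˢ T).card + 1 := by gcongr; exact Finset.card_image_le
        _ = S.card * T.card + 1 := by rw [Finset.card_product]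
        _ ≤ S.card * (S.card + 1) ^ p + (S.card + 1) ^ p := by
          gcongr
          exact Nat.one_le_pow _ _ (Nat.succ_pos _)
        _ = (S.card + 1) ^ (p + 1) := by ring
    · cases l with
      | nil => simp
      | cons a l =>
        simp only [List.mem_cons, forall_eq_or_imp] at hS
        have := hmem l (by simpa using hl) hS.2
        simp [hS.1, this]

theorem exists_finset_bitLists (b p : ℕ) :
    ∃ T : Finset (List (List Bool)), T.card ≤ 4 ^ ((b + 1) * p) ∧
      ∀ l : List (List Bool), l.length ≤ p → (∀ x ∈ l, x.length ≤ b) → l ∈ T := by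
  obtain ⟨S, hS, hmem⟩ := exists_finset_lists (Finset.univ : Finset Bool) b
  obtain ⟨T, hT, hmem'⟩ := exists_finset_lists S p
  refine ⟨T, hT.trans ?_, fun l hl hx => hmem' l hl fun x h => hmem x (hx x h) (by simp)⟩
  rw [pow_mul]
  gcongr
  have h3 : S.card ≤ 3 ^ b := by simpa using hS
  have h4 : 3 ^ b ≤ 4 ^ b := Nat.pow_le_pow_left (by norm_num) b
  have h5 : 1 ≤ 4 ^ b := Nat.one_le_pow _ _ (by norm_num)
  rw [pow_succ]
  omega

/-! ### Periodic strings -/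

/-- The string of length `n` that consists of repetitions of `r`. -/
def periodicString {α : Type*} {ℓ : ℕ} [NeZero ℓ] (r : Fin ℓ → α) (n : ℕ) : List α :=
  (List.range n).map fun i => r (Fin.ofNat ℓ i)

section periodicString

variable {α : Type*} {ℓ : ℕ} [NeZero ℓ]

theorem length_periodicString (r : Fin ℓ → α) (n : ℕ) : (periodicString r n).length = n := by
  simp [periodicString]

theorem ofNat_add_mul_self (i j : ℕ) : Fin.ofNat ℓ (j * ℓ + i) = Fin.ofNat ℓ i := by
  ext
  simp [Fin.ofNat]

theorem periodicString_add (r : Fin ℓ → α) (j n : ℕ) :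
    periodicString r (j * ℓ + n) = periodicString r (j * ℓ) ++ periodicString r n := by
  simp only [periodicString, List.range_add, List.map_append, List.map_map, Function.comp_def,
    ofNat_add_mul_self]

theorem periodicString_injective {r r' : Fin ℓ → α}
    (h : periodicString r ℓ = periodicString r' ℓ) : r = r' := by
  funext i
  have := congrArg (fun l => l[(i : ℕ)]?) h
  simpa [periodicString] using this

end periodicString

/-- Whether the output stream belongs to the stored encoding. -/
def Readout.hasOut : Readout → Bool
  | .output => true
  | .tape => false
  | .both => true

/-- Whether the final tape belongs to the stored encoding. -/
def Readout.hasTape : Readout → Bool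
  | .output => false
  | .tape => true
  | .both => true

/-! ### Recovering the period from a cheap copy -/

theorem Readout.encoding_eq {Γ : Type} (ro : Readout) (C : StreamConfig Γ) :
    ro.encoding C = (if ro.hasOut then C.out else [], if ro.hasTape then C.tape else []) := by
  cases ro <;> rfl

/-- The factors of the bound count, in order, the index of a cheap copy, the memory contents on
entering and on leaving it, its outputs and its final tape. -/
theorem card_le_of_encodingBits_le {σ : ℕ} {Γ : Type} [Fintype Γ] (hσ : 2 ≤ σ)
    (A : WStreamsAlg σ Γ) (ro : Readout) {n ℓ m b p B : ℕ} [NeZero ℓ] (hm : 0 < m)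
    (hmn : m * ℓ ≤ n) (hmem : ∀ s : List (Fin σ), s.length = n → A.UsesMemory s b)
    (hinj : Set.InjOn (fun s => ro.encoding (A.after s p)) {s : List (Fin σ) | s.length = n})
    (F : Finset (Fin ℓ → Fin σ)) (E : ℝ) (hE : E < m * (B + 1))
    (hF : ∀ r ∈ F, encodingBits (ro.encoding (A.after (periodicString r n) p)) ≤ E) :
    F.card ≤ m * (4 ^ ((b + 1) * p) * (4 ^ ((b + 1) * p) *
      (4 ^ ((B + 1) * p) * (Fintype.card Γ + 1) ^ B))) := by
  classical
  obtain ⟨n', rfl⟩ := Nat.exists_eq_add_of_le hmn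
  -- With two or more symbols, each tape symbol costs at least one bit, so few bits means a short
  -- tape.
  have hG : 2 ≤ Fintype.card Γ := by
    have := Fintype.card_le_of_embedding A.input
    simp at this
    omega
  have hlog : 1 ≤ Real.logb 2 (Fintype.card Γ : ℝ) := by
    rw [Real.le_logb_iff_rpow_le (by norm_num) (by positivity)]
    simpa using (by exact_mod_cast hG : (2 : ℝ) ≤ Fintype.card Γ)
  obtain ⟨T, hT, hTmem⟩ := exists_finset_bitLists b p
  obtain ⟨T', hT', hTmem'⟩ := exists_finset_bitLists B p
  obtain ⟨S, hS, hSmem⟩ := exists_finset_lists (Finset.univ : Finset Γ) B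
  let C₀ : (Fin ℓ → Fin σ) → StreamConfig Γ := fun r =>
    ⟨A.start, (periodicString r (m * ℓ + n')).map A.input, [], false⟩
  let Y : (Fin ℓ → Fin σ) → List Γ := fun r => (periodicString r ℓ).map A.input
  let U : (Fin ℓ → Fin σ) → ℕ → List Γ := fun r i => (periodicString r (i * ℓ)).map A.input
  let Z : (Fin ℓ → Fin σ) → ℕ → List Γ := fun r i => (periodicString r i).map A.input
  have hU : ∀ r i, U r (i + 1) = U r i ++ Y r := fun r i => by
    simp only [U, Y, add_mul, one_mul, periodicString_add, List.map_append]
  have hC₀ : ∀ r i, i ≤ m → (C₀ r).tape = U r i ++ Z r ((m - i) * ℓ + n') := fun r i hi => by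
    simp only [C₀, U, Z, ← List.map_append, ← periodicString_add]
    congr 2
    rw [← add_assoc, ← add_mul, Nat.add_sub_cancel' hi]
  let μ : (Fin ℓ → Fin σ) → ℕ → List (List Bool) := fun r i =>
    (A.trace (A.startMems p (C₀ r)) (U r i)).mems
  let tr : (Fin ℓ → Fin σ) → ℕ → PassTrace Γ := fun r i => A.trace (μ r i) (Y r)
  have hμlen : ∀ r i, (μ r i).length ≤ p := fun r i => by
    simpa only [μ, WStreamsAlg.trace_mems_length] using A.startMems_length_le p (C₀ r)
  have hμb : ∀ r i, i ≤ m → ∀ x ∈ μ r i, x.length ≤ b := fun r i hi =>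
    A.length_le_of_mem_trace_mems b p (C₀ r) _ _ (hC₀ r i hi)
      (hmem _ (length_periodicString _ _))
  have hμsucc : ∀ r i, (tr r i).mems = μ r (i + 1) := fun r i => by
    simp only [tr, μ, hU, A.trace_append]
  have hex : ∀ r : Fin ℓ → Fin σ, ∃ i < m, r ∈ F →
      (ro.hasOut → ∀ x ∈ (tr r i).outs, x.length ≤ B) ∧
      (ro.hasTape → (tr r i).tape.length ≤ B) := by
    intro r
    by_cases hr : r ∈ F
    swap
    · exact ⟨0, hm, fun h => absurd h hr⟩
    -- Weight zero removes from the cost whatever is not stored, since nothing bounds its length;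
    -- `D` blanks the same components.
    let α : ℝ := if ro.hasOut then 1 else 0
    let β : ℝ := if ro.hasTape then Real.logb 2 (Fintype.card Γ : ℝ) else 0
    have hα : 0 ≤ α := by simp only [α]; split <;> norm_num
    have hβ : 0 ≤ β := by simp only [β]; split <;> linarith
    obtain ⟨i, hi, hcost⟩ := A.exists_trace_cost_le (A.startMems p (C₀ r)) (U r) (Y r) (hU r)
      α β hα hβ m hm
    refine ⟨i, hi, fun _ => ?_⟩
    have htot := A.trace_cost_le p (C₀ r) _ _ (hC₀ r m le_rfl)
    have hbits : α * ((A.pass^[p] (C₀ r)).out.length : ℝ) +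
        β * ((A.pass^[p] (C₀ r)).tape.length : ℝ) ≤ E := by
      refine le_trans (le_of_eq ?_) (hF r hr)
      rw [Readout.encoding_eq, encodingBits]
      change α * ((A.after (periodicString r (m * ℓ + n')) p).out.length : ℝ) +
        β * ((A.after (periodicString r (m * ℓ + n')) p).tape.length : ℝ) = _
      simp only [α, β]
      split <;> split <;> simp [mul_comm]
    have hlt : α * (((tr r i).outs.map List.length).sum : ℕ) + β * ((tr r i).tape.length : ℝ) <
        B + 1 := by
      have hm' : (0 : ℝ) < m := by exact_mod_cast hm
      refine lt_of_mul_lt_mul_left (lt_of_le_of_lt (hcost.trans ?_) hE) hm'.le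
      refine le_trans ?_ hbits
      refine add_le_add (mul_le_mul_of_nonneg_left ?_ hα) (mul_le_mul_of_nonneg_left ?_ hβ)
      · exact_mod_cast (Nat.le_add_left _ _).trans htot.1
      · exact_mod_cast htot.2
    have h1 : 0 ≤ α * (((tr r i).outs.map List.length).sum : ℕ) := by positivity
    have h2 : 0 ≤ β * ((tr r i).tape.length : ℝ) := by positivity
    refine ⟨fun ho x hx => ?_, fun ht => ?_⟩
    · have h3 : ((((tr r i).outs.map List.length).sum : ℕ) : ℝ) < B + 1 := by
        simp only [α, ho, if_true, one_mul] at hlt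
        linarith
      have h4 : x.length ≤ ((tr r i).outs.map List.length).sum :=
        List.single_le_sum (by simp) _ (List.mem_map_of_mem hx)
      have h5 : ((tr r i).outs.map List.length).sum < B + 1 := by exact_mod_cast h3
      omega
    · have h3 : ((tr r i).tape.length : ℝ) < B + 1 := by
        simp only [β, ht, if_true] at hlt h2
        nlinarith [(Nat.cast_nonneg (tr r i).tape.length : (0 : ℝ) ≤ _)]
      have h5 : (tr r i).tape.length < B + 1 := by exact_mod_cast h3
      omega
  choose idx hidx hcheap using hex
  let D : (Fin ℓ → Fin σ) → ℕ × List (List Bool) × List (List Bool) × List (List Bool) × List Γ :=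
    fun r => (idx r, μ r (idx r), (tr r (idx r)).mems,
      (if ro.hasOut then (tr r (idx r)).outs else []),
      (if ro.hasTape then (tr r (idx r)).tape else []))
  have hmaps : ∀ r ∈ F, D r ∈ Finset.range m ×ˢ T ×ˢ T ×ˢ T' ×ˢ S := by
    intro r hr
    simp only [D, Finset.mem_product, Finset.mem_range]
    refine ⟨hidx r, hTmem _ (hμlen _ _) (hμb _ _ (hidx r).le), ?_, ?_, ?_⟩
    · rw [hμsucc]
      exact hTmem _ (hμlen _ _) (hμb _ _ (hidx r))
    · refine hTmem' _ ?_ ?_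
      · split
        · simpa only [tr, A.trace_outs_length] using hμlen r (idx r)
        · simp
      · split
        · exact (hcheap r hr).1 ‹_›
        · simp
    · refine hSmem _ ?_ (by simp)
      split
      · exact (hcheap r hr).2 ‹_›
      · simp
  have hDinj : Set.InjOn D F := by
    intro r hr r' hr' hD
    simp only [D, Prod.mk.injEq] at hD
    obtain ⟨hi, h1, h2, h3, h4⟩ := hD
    set i := idx r with hidef
    have him : i < m := hidx r
    rw [← hi] at h1 h2 h3 h4
    have htape : m * ℓ + n' = i * ℓ + (ℓ + ((m - (i + 1)) * ℓ + n')) := by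
      obtain ⟨d, hd⟩ := Nat.exists_eq_add_of_lt him
      have : m - (i + 1) = d := by omega
      rw [this, hd]
      ring
    set q := (m - (i + 1)) * ℓ + n' with hq
    have hs : periodicString r (m * ℓ + n') =
        periodicString r (i * ℓ) ++ periodicString r ℓ ++ periodicString r q := by
      rw [htape, periodicString_add, List.append_assoc]
      congr 1
      simpa using periodicString_add r 1 q
    -- The hybrid string: only copy `i` of `r` is replaced by `r'`. It need not be periodic, but
    -- injectivity covers all strings of length `n`.
    set s' := periodicString r (i * ℓ) ++ periodicString r' ℓ ++ periodicString r q with hs'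
    have hlen' : s'.length = m * ℓ + n' := by
      rw [hs', htape]
      simp [length_periodicString]
    have hrep := A.iterate_pass_replace p A.start (U r i) (Y r) (Y r') (Z r q) [] [] false
    have hC : (⟨A.start, U r i ++ Y r ++ Z r q, [], false⟩ : StreamConfig Γ) = C₀ r := by
      simp only [C₀, U, Y, Z, hs, List.map_append]
    rw [hC] at hrep
    have htr' : A.trace (μ r i) (Y r') = tr r' i := by simp only [tr, h1]
    have hrep' := hrep (by
      change (tr r i).mems = (A.trace (μ r i) (Y r')).mems
      rw [htr', h2])
    have henc : ro.encoding (A.after (periodicString r (m * ℓ + n')) p) =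
        ro.encoding (A.after s' p) := by
      rw [Readout.encoding_eq, Readout.encoding_eq]
      have hA' : A.after s' p = A.pass^[p] ⟨A.start, U r i ++ Y r' ++ Z r q, [], false⟩ := by
        simp only [WStreamsAlg.after, hs', U, Y, Z, List.map_append]
      rw [hA']
      change (_, if ro.hasTape then (A.pass^[p] (C₀ r)).tape else []) = _
      refine Prod.ext ?_ ?_
      · change (if ro.hasOut then (A.pass^[p] (C₀ r)).out else []) = _
        by_cases ho : ro.hasOut = true
        · simp only [ho, if_true] at h3 ⊢
          refine hrep'.1 rfl ?_
          change (tr r i).outs = (A.trace (μ r i) (Y r')).outs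
          rw [htr', h3]
        · simp [ho]
      · by_cases ht : ro.hasTape = true
        · simp only [ht, if_true] at h4 ⊢
          refine hrep'.2 ?_
          change (tr r i).tape = (A.trace (μ r i) (Y r')).tape
          rw [htr', h4]
        · simp [ht]
    have hss := hinj (length_periodicString r _) hlen' henc
    rw [hs, hs'] at hss
    simp only [List.append_assoc, List.append_cancel_left_eq, List.append_cancel_right_eq] at hss
    exact periodicString_injective hss
  calc F.card ≤ (Finset.range m ×ˢ T ×ˢ T ×ˢ T' ×ˢ S).card :=
        Finset.card_le_card_of_injOn D hmaps hDinj
    _ = m * (T.card * (T.card * (T'.card * S.card))) := by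
        simp only [Finset.card_product, Finset.card_range]
    _ ≤ _ := by
        gcongr
        simpa using hS

/-! ### Strings with few repeated contexts -/

section collisions

variable {α : Type*} {ℓ : ℕ} [NeZero ℓ]

/-- The windows of length `k` at the positions `a` and `b` of the cyclic string `r` are equal. -/
def Collide (r : Fin ℓ → α) (k a b : ℕ) : Prop :=
  ∀ t < k, r (Fin.ofNat ℓ (a + t)) = r (Fin.ofNat ℓ (b + t))

open Classical in
/-- The pairs of distinct positions of the cyclic string `r` with the same windows of length `k`. -/
noncomputable def collisions (r : Fin ℓ → α) (k : ℕ) : Finset (ℕ × ℕ) :=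
  (Finset.range ℓ ×ˢ Finset.range ℓ).filter fun x => x.1 ≠ x.2 ∧ Collide r k x.1 x.2

theorem ofNat_add_self (i : ℕ) : Fin.ofNat ℓ (i + ℓ) = Fin.ofNat ℓ i := by
  ext
  simp [Fin.ofNat]

open Classical in
-- The `ℓ - k` letters at offsets `d + k, …, d + ℓ - 1` from `a` determine `r`: offsets below `d`
-- wrap around into this range, and the collision propagates letters from offset `x - d` to `x`,
-- even when the windows overlap.
theorem card_collide_shift_le [Fintype α] (k a d : ℕ) (hd : 0 < d) (hdk : d + k ≤ ℓ) (ha : a < ℓ) :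
    ((Finset.univ : Finset (Fin ℓ → α)).filter fun r => Collide r k a (a + d)).card ≤
      Fintype.card α ^ (ℓ - k) := by
  have hcard : Fintype.card α ^ (ℓ - k) =
      (Finset.univ : Finset (Fin (ℓ - k) → α)).card := by simp
  rw [hcard]
  refine Finset.card_le_card_of_injOn
    (fun r t => r (Fin.ofNat ℓ (a + (d + k + t)))) (fun _ _ => by simp) ?_
  intro r hr r' hr' h
  simp only [Finset.coe_filter, Finset.mem_univ, true_and, Set.mem_ofPred_eq] at hr hr'
  have hout : ∀ x, d + k ≤ x → x < d + ℓ →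
      r (Fin.ofNat ℓ (a + x)) = r' (Fin.ofNat ℓ (a + x)) := by
    intro x hx hx'
    have := congrFun h ⟨x - (d + k), by omega⟩
    simpa only [Nat.add_sub_cancel' hx] using this
  have hall : ∀ x < d + ℓ, r (Fin.ofNat ℓ (a + x)) = r' (Fin.ofNat ℓ (a + x)) := by
    intro x
    induction x using Nat.strong_induction_on with
    | _ x ih =>
      intro hx
      rcases le_or_gt (d + k) x with h1 | h1
      · exact hout x h1 hx
      rcases le_or_gt d x with h2 | h2
      · have e1 := hr (x - d) (by omega)
        have e2 := hr' (x - d) (by omega)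
        have e3 : a + d + (x - d) = a + x := by omega
        rw [e3] at e1 e2
        rw [← e1, ← e2]
        exact ih _ (by omega) (by omega)
      · have := hout (x + ℓ) (by omega) (by omega)
        rwa [← add_assoc, ofNat_add_self] at this
  funext y
  have hy : Fin.ofNat ℓ (a + ((y : ℕ) + ℓ - a) % ℓ) = y := by
    ext
    simp only [Fin.val_ofNat, Nat.add_mod_mod]
    have : a + ((y : ℕ) + ℓ - a) = y + ℓ := by omega
    rw [this]
    simp [Nat.mod_eq_of_lt y.isLt]
  have := hall (((y : ℕ) + ℓ - a) % ℓ) (by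
    have := Nat.mod_lt ((y : ℕ) + ℓ - a) (Nat.pos_of_ne_zero (NeZero.ne ℓ)); omega)
  rwa [hy] at this

theorem Collide.symm {r : Fin ℓ → α} {k a b : ℕ} (h : Collide r k a b) : Collide r k b a :=
  fun t ht => (h t ht).symm

theorem collide_add_self {r : Fin ℓ → α} {k a b : ℕ} :
    Collide r k a (b + ℓ) ↔ Collide r k a b := by
  unfold Collide
  have : ∀ t, b + ℓ + t = b + t + ℓ := fun t => by ring
  simp only [this, ofNat_add_self]

open Classical in
-- The two cyclic distances between `a` and `b` sum to `ℓ ≥ 2k`, so at least one of them is at most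
-- `ℓ - k`.
theorem card_collide_le [Fintype α] {k a b : ℕ} (hk : 2 * k ≤ ℓ) (ha : a < ℓ) (hb : b < ℓ)
    (hab : a ≠ b) :
    ((Finset.univ : Finset (Fin ℓ → α)).filter fun r => Collide r k a b).card ≤
      Fintype.card α ^ (ℓ - k) := by
  wlog hlt : a < b generalizing a b with H
  · have := H hb ha hab.symm (by omega)
    refine le_of_eq_of_le ?_ this
    congr 1
    ext r
    simpa using ⟨Collide.symm, Collide.symm⟩
  rcases le_or_gt (b + k) (a + ℓ) with h | h
  · have := card_collide_shift_le (α := α) k a (b - a) (by omega) (by omega) ha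
    rwa [Nat.add_sub_cancel' hlt.le] at this
  · have := card_collide_shift_le (α := α) k b (a + ℓ - b) (by omega) (by omega) hb
    rw [Nat.add_sub_cancel' (by omega)] at this
    refine le_of_eq_of_le ?_ this
    congr 1
    ext r
    simp only [Finset.mem_filter, Finset.mem_univ, true_and, collide_add_self]
    exact ⟨Collide.symm, Collide.symm⟩

/-- At least half of all cyclic strings have at most twice the expected number of collisions. -/
theorem card_few_collisions [Fintype α] {k : ℕ} (hk : 2 * k ≤ ℓ) :
    Fintype.card α ^ ℓ ≤ 2 * ((Finset.univ : Finset (Fin ℓ → α)).filter fun r =>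
      (collisions r k).card * Fintype.card α ^ k ≤ 2 * ℓ ^ 2).card := by
  classical
  set N := Fintype.card α
  have hℓ : 0 < ℓ := Nat.pos_of_ne_zero (NeZero.ne ℓ)
  have hsum : ∑ r : Fin ℓ → α, (collisions r k).card ≤ ℓ ^ 2 * N ^ (ℓ - k) := by
    simp only [collisions, Finset.card_filter]
    rw [Finset.sum_comm]
    calc _ ≤ ∑ x ∈ Finset.range ℓ ×ˢ Finset.range ℓ, N ^ (ℓ - k) := by
          refine Finset.sum_le_sum fun x hx => ?_
          simp only [Finset.mem_product, Finset.mem_range] at hx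
          by_cases h : x.1 = x.2
          · simp [h]
          · simpa [h, ← Finset.card_filter] using card_collide_le (α := α) hk hx.1 hx.2 h
      _ = _ := by simp [sq]
  have hsplit := Finset.card_filter_add_card_filter_not (s := (Finset.univ : Finset (Fin ℓ → α)))
    (fun r => (collisions r k).card * N ^ k ≤ 2 * ℓ ^ 2)
  set good := (Finset.univ : Finset (Fin ℓ → α)).filter fun r =>
      (collisions r k).card * N ^ k ≤ 2 * ℓ ^ 2
  set bad := (Finset.univ : Finset (Fin ℓ → α)).filter fun r =>
      ¬ (collisions r k).card * N ^ k ≤ 2 * ℓ ^ 2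
  -- Markov's inequality, multiplied out to stay in `ℕ`.
  have hbad : bad.card * (2 * ℓ ^ 2) ≤ ℓ ^ 2 * N ^ ℓ := by
    calc bad.card * (2 * ℓ ^ 2) = ∑ r ∈ bad, 2 * ℓ ^ 2 := by simp
      _ ≤ ∑ r ∈ bad, (collisions r k).card * N ^ k := by
          refine Finset.sum_le_sum fun r hr => ?_
          simp only [bad, Finset.mem_filter, not_le] at hr
          exact hr.2.le
      _ ≤ ∑ r : Fin ℓ → α, (collisions r k).card * N ^ k :=
          Finset.sum_le_sum_of_subset (Finset.subset_univ _)
      _ = (∑ r : Fin ℓ → α, (collisions r k).card) * N ^ k := by rw [Finset.sum_mul]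
      _ ≤ ℓ ^ 2 * N ^ (ℓ - k) * N ^ k := by gcongr
      _ = ℓ ^ 2 * N ^ ℓ := by rw [mul_assoc, ← pow_add, Nat.sub_add_cancel (by omega)]
  have hbad' : 2 * bad.card ≤ N ^ ℓ := by
    refine Nat.le_of_mul_le_mul_left ?_ (pow_pos hℓ 2)
    linarith
  have hcard : (Finset.univ : Finset (Fin ℓ → α)).card = N ^ ℓ := by simp [N]
  omega

end collisions

/-! ### The entropy of a periodic string -/

theorem length_mul_entropy₀_le {α : Type*} [DecidableEq α] (s : List α) :
    (s.length : ℝ) * entropy₀ s ≤ s.length * Real.logb 2 s.length := by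
  rcases s.eq_nil_or_concat with rfl | ⟨_, _, hs⟩
  · simp
  have hpos : 0 < s.length := by simp [hs]
  have hn : (0 : ℝ) < s.length := by exact_mod_cast hpos
  unfold entropy₀
  rw [← mul_assoc, mul_one_div_cancel hn.ne', one_mul]
  calc _ ≤ ∑ a ∈ s.toFinset, (s.count a : ℝ) * Real.logb 2 s.length := by
        refine Finset.sum_le_sum fun a ha => ?_
        have h1 : 0 < s.count a := List.count_pos_iff.mpr (by simpa using ha)
        have h2 : (1 : ℝ) ≤ s.count a := by exact_mod_cast h1
        gcongr
        · norm_num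
        · exact div_le_self hn.le h2
    _ = _ := by
        rw [← Finset.sum_mul]
        congr 1
        exact_mod_cast List.sum_toFinset_count_eq_length s

theorem entropy₀_eq_zero {α : Type*} [DecidableEq α] {s : List α} {a : α}
    (h : ∀ x ∈ s, x = a) : entropy₀ s = 0 := by
  unfold entropy₀
  refine mul_eq_zero_of_right _ (Finset.sum_eq_zero fun x hx => ?_)
  have hx' : x ∈ s := by simpa using hx
  have hc : s.count x = s.length := List.count_eq_length.mpr fun y hy => by rw [h x hx', h y hy]
  have hpos : (s.length : ℝ) ≠ 0 := by
    have := List.length_pos_of_mem hx'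
    positivity
  simp [hc, div_self hpos]

theorem entropy₀_nonneg {α : Type*} [DecidableEq α] (s : List α) : 0 ≤ entropy₀ s := by
  refine mul_nonneg (by positivity) (Finset.sum_nonneg fun a ha => ?_)
  have h1 : 0 < s.count a := List.count_pos_iff.mpr (by simpa using ha)
  refine mul_nonneg (by positivity) (Real.logb_nonneg (by norm_num) ?_)
  rw [one_le_div (by exact_mod_cast h1)]
  exact_mod_cast List.count_le_length

theorem entropy_nonneg {α : Type*} [DecidableEq α] [Fintype α] (k : ℕ) (s : List α) :
    0 ≤ entropy k s :=
  mul_nonneg (by positivity)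
    (Finset.sum_nonneg fun _ _ => mul_nonneg (by positivity) (entropy₀_nonneg _))

section followers

variable {α : Type*} {ℓ : ℕ}

theorem card_filter_mod_eq_le (n a : ℕ) :
    ((Finset.range n).filter fun i => i % ℓ = a).card ≤ n / ℓ + 1 := by
  refine (Finset.card_le_card_of_injOn (t := Finset.range (n / ℓ + 1)) (· / ℓ) ?_ ?_).trans
    (by simp)
  · intro i hi
    simp only [Finset.coe_filter, Finset.mem_range, Set.mem_ofPred_eq] at hi
    have := Nat.div_le_div_right (c := ℓ) hi.1.le
    simp only [Finset.coe_range, Set.mem_Iio]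
    omega
  · intro i hi j hj h
    simp only [Finset.coe_filter, Finset.mem_range, Set.mem_ofPred_eq] at hi hj h
    rw [← Nat.div_add_mod i ℓ, ← Nat.div_add_mod j ℓ, hi.2, hj.2, h]

variable [NeZero ℓ]

theorem ofNat_mod_add (i t : ℕ) : Fin.ofNat ℓ (i % ℓ + t) = Fin.ofNat ℓ (i + t) := by
  ext
  simp [Fin.ofNat]

theorem take_drop_periodicString_eq_iff (r : Fin ℓ → α) {n k i : ℕ} (w : Fin k → α)
    (hi : i + k ≤ n) : ((periodicString r n).drop i).take k = List.ofFn w ↔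
      ∀ t : Fin k, r (Fin.ofNat ℓ (i + t)) = w t := by
  have hlen : (((periodicString r n).drop i).take k).length = k := by
    simp [length_periodicString]
    omega
  rw [List.ext_get_iff]
  simp only [hlen, List.length_ofFn, true_and]
  constructor
  · intro h t
    simpa [periodicString] using h t t.isLt t.isLt
  · intro h t h1 h2
    simpa [periodicString] using h ⟨t, h1⟩

variable [DecidableEq α]

/-- The positions of the occurrences of `w` that are followed by a character. -/
def contextPositions (r : Fin ℓ → α) (n : ℕ) {k : ℕ} (w : Fin k → α) : Finset ℕ :=
  (Finset.range n).filter fun i => i + k < n ∧ ∀ t : Fin k, r (Fin.ofNat ℓ (i + t)) = w t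

theorem followers_periodicString (r : Fin ℓ → α) (n : ℕ) {k : ℕ} (w : Fin k → α) :
    followers (periodicString r n) (List.ofFn w) =
      (List.range n).filterMap fun i => if i ∈ contextPositions r n w then
        some (r (Fin.ofNat ℓ (i + k))) else none := by
  unfold followers
  rw [length_periodicString]
  refine List.filterMap_congr fun i hi => ?_
  have hi' : i < n := by simpa using hi
  simp only [List.length_ofFn, contextPositions, Finset.mem_filter, Finset.mem_range, hi', true_and]
  by_cases hk : i + k < n
  · simp only [take_drop_periodicString_eq_iff r w hk.le, hk, true_and]
    congr 1
    simp [periodicString, hk]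
  · have : (periodicString r n)[i + k]? = none := by
      simp [length_periodicString]; omega
    simp [hk, this]

theorem length_followers_periodicString (r : Fin ℓ → α) (n : ℕ) {k : ℕ} (w : Fin k → α) :
    (followers (periodicString r n) (List.ofFn w)).length = (contextPositions r n w).card := by
  rw [followers_periodicString, List.length_filterMap_eq_countP]
  have hsub : contextPositions r n w =
      ((List.range n).filter fun i => i ∈ contextPositions r n w).toFinset := by
    ext i
    simp only [List.mem_toFinset, List.mem_filter, List.mem_range, decide_eq_true_eq]
    exact ⟨fun h => ⟨by simpa using (Finset.mem_filter.mp h).1, h⟩, fun h => h.2⟩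
  conv_rhs => rw [hsub]
  rw [List.toFinset_card_of_nodup (List.nodup_range.filter _), ← List.countP_eq_length_filter]
  refine List.countP_congr fun i _ => ?_
  by_cases h : i ∈ contextPositions r n w <;> simp [h]

theorem mul_entropy_periodicString_le [Fintype α] (r : Fin ℓ → α) (n k : ℕ) (hn : 0 < n) :
    (n : ℝ) * entropy k (periodicString r n) ≤
      ((n / ℓ + 1) * (collisions r k).card : ℕ) * Real.logb 2 n := by
  classical
  have hℓ : 0 < ℓ := Nat.pos_of_ne_zero (NeZero.ne ℓ)
  have hn' : (0 : ℝ) < n := by exact_mod_cast hn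
  have hlog : 0 ≤ Real.logb 2 n := Real.logb_nonneg (by norm_num) (by exact_mod_cast hn)
  unfold entropy
  rw [length_periodicString, ← mul_assoc, mul_one_div_cancel hn'.ne', one_mul]
  -- Positions whose residue takes part in a collision: the only ones that can contribute entropy,
  -- each at most `log₂ n`.
  let J : Finset ℕ := (Finset.range n).filter fun i => i % ℓ ∈ (collisions r k).image Prod.fst
  have hJ : J.card ≤ (n / ℓ + 1) * (collisions r k).card := by
    have : J = ((collisions r k).image Prod.fst).biUnion fun a =>
        (Finset.range n).filter fun i => i % ℓ = a := by
      ext i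
      simp only [J, Finset.mem_filter, Finset.mem_biUnion]
      constructor
      · rintro ⟨h1, h2⟩
        exact ⟨_, h2, h1, rfl⟩
      · rintro ⟨a, h1, h2, rfl⟩
        exact ⟨h2, h1⟩
    rw [this, mul_comm]
    refine Finset.card_biUnion_le_card_mul _ _ _ (fun a _ => card_filter_mod_eq_le n a) |>.trans ?_
    gcongr
    exact Finset.card_image_le
  have hw : ∀ w : Fin k → α,
      ((followers (periodicString r n) (List.ofFn w)).length : ℝ) *
        entropy₀ (followers (periodicString r n) (List.ofFn w)) ≤
      ((J.filter fun i => (fun t : Fin k => r (Fin.ofNat ℓ (i + t))) = w).card : ℝ) *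
        Real.logb 2 n := by
    intro w
    by_cases hamb : ∀ i ∈ contextPositions r n w, ∀ j ∈ contextPositions r n w, i % ℓ = j % ℓ
    · have hzero : entropy₀ (followers (periodicString r n) (List.ofFn w)) = 0 := by
        rcases (contextPositions r n w).eq_empty_or_nonempty with he | ⟨j, hj⟩
        · have h0 := length_followers_periodicString r n w
          rw [he, Finset.card_empty, List.length_eq_zero_iff] at h0
          simp [h0, entropy₀]
        · refine entropy₀_eq_zero (a := r (Fin.ofNat ℓ (j + k))) fun x hx => ?_
          rw [followers_periodicString, List.mem_filterMap] at hx
          obtain ⟨i, -, hi⟩ := hx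
          split at hi
          · rename_i hi'
            simp only [Option.some.injEq] at hi
            rw [← hi, ← ofNat_mod_add, hamb i hi' j hj, ofNat_mod_add]
          · simp at hi
      rw [hzero, mul_zero]
      positivity
    · push Not at hamb
      obtain ⟨i₁, h₁, i₂, h₂, hne⟩ := hamb
      have hsub : contextPositions r n w ⊆
          J.filter fun i => (fun t : Fin k => r (Fin.ofNat ℓ (i + t))) = w := by
        intro i hi
        have hpair : ∀ j ∈ contextPositions r n w, i % ℓ ≠ j % ℓ →
            i % ℓ ∈ (collisions r k).image Prod.fst := by
          intro j hj hij
          refine Finset.mem_image.mpr ⟨(i % ℓ, j % ℓ), ?_, rfl⟩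
          simp only [collisions, Finset.mem_filter, Finset.mem_product, Finset.mem_range,
            Nat.mod_lt _ hℓ, true_and]
          refine ⟨hij, fun t ht => ?_⟩
          rw [ofNat_mod_add, ofNat_mod_add]
          exact ((Finset.mem_filter.mp hi).2.2 ⟨t, ht⟩).trans
            ((Finset.mem_filter.mp hj).2.2 ⟨t, ht⟩).symm
        refine Finset.mem_filter.mpr ⟨Finset.mem_filter.mpr ⟨(Finset.mem_filter.mp hi).1, ?_⟩,
          funext (Finset.mem_filter.mp hi).2.2⟩
        -- Every occurrence differs modulo `ℓ` from `i₁` or from `i₂`, hence collides with one of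
        -- them.
        by_cases h : i % ℓ = i₁ % ℓ
        · exact hpair i₂ h₂ (h ▸ hne)
        · exact hpair i₁ h₁ h
      refine (length_mul_entropy₀_le _).trans ?_
      rw [length_followers_periodicString]
      have hle : (contextPositions r n w).card ≤ n := by
        have := Finset.card_le_card (Finset.filter_subset _ _ :
          contextPositions r n w ⊆ Finset.range n)
        rwa [Finset.card_range] at this
      have hpos : 0 < (contextPositions r n w).card := Finset.card_pos.mpr ⟨i₁, h₁⟩
      have hpos' : (0 : ℝ) < (contextPositions r n w).card := by exact_mod_cast hpos
      have := Finset.card_le_card hsub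
      gcongr
      · exact Real.logb_nonneg (by norm_num) (by exact_mod_cast hpos)
      · norm_num
  calc _ ≤ ∑ w : Fin k → α,
        ((J.filter fun i => (fun t : Fin k => r (Fin.ofNat ℓ (i + t))) = w).card : ℝ) *
          Real.logb 2 n := Finset.sum_le_sum fun w _ => hw w
    _ = (J.card : ℝ) * Real.logb 2 n := by
        rw [← Finset.sum_mul]
        congr 1
        -- Each position starts exactly one cyclic window, so the fibres partition `J`.
        have := Finset.card_eq_sum_card_fiberwise (s := J) (t := Finset.univ)
          (f := fun i => (fun t : Fin k => r (Fin.ofNat ℓ (i + t)))) (fun _ _ => by simp)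
        exact_mod_cast this.symm
    _ ≤ _ := by gcongr

end followers

/-! ### Asymptotics -/

theorem isLittleO_natCast_rpow_rpow {a b : ℝ} (h : a < b) :
    (fun n : ℕ => (n : ℝ) ^ a) =o[atTop] fun n : ℕ => (n : ℝ) ^ b := by
  have h1 : (fun x : ℝ => x ^ a) =o[atTop] fun x : ℝ => x ^ b := by
    refine isLittleO_of_tendsto' ?_ ?_
    · filter_upwards [eventually_gt_atTop 0] with x hx h0
      exact absurd h0 (Real.rpow_pos_of_pos hx b).ne'
    · refine (tendsto_rpow_neg_atTop (sub_pos.mpr h)).congr' ?_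
      filter_upwards [eventually_gt_atTop 0] with x hx
      rw [← Real.rpow_sub hx, neg_sub]
  exact h1.comp_tendsto tendsto_natCast_atTop_atTop

theorem isLittleO_natCast_log_pow_rpow (e : ℕ) {b : ℝ} (h : 0 < b) :
    (fun n : ℕ => Real.log (n : ℝ) ^ e) =o[atTop] fun n : ℕ => (n : ℝ) ^ b := by
  have h1 := isLittleO_log_rpow_rpow_atTop (e : ℝ) h
  simp only [Real.rpow_natCast] at h1
  exact h1.comp_tendsto tendsto_natCast_atTop_atTop

theorem isLittleO_natCast_log_rpow {b : ℝ} (h : 0 < b) :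
    (fun n : ℕ => Real.log (n : ℝ)) =o[atTop] fun n : ℕ => (n : ℝ) ^ b := by
  simpa using isLittleO_natCast_log_pow_rpow 1 h

theorem isLittleO_const_natCast_rpow (K : ℝ) {b : ℝ} (h : 0 < b) :
    (fun _ : ℕ => K) =o[atTop] fun n : ℕ => (n : ℝ) ^ b := by
  have := (isLittleO_natCast_rpow_rpow h).const_mul_left K
  simpa using this

theorem eventually_le_rpow_of_isLittleO {f : ℕ → ℝ} {b : ℝ}
    (h : f =o[atTop] fun n : ℕ => (n : ℝ) ^ b) : ∀ᶠ n : ℕ in atTop, f n ≤ (n : ℝ) ^ b := by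
  filter_upwards [h.def one_pos] with n hn
  rw [one_mul, Real.norm_of_nonneg (by positivity : (0 : ℝ) ≤ (n : ℝ) ^ b)] at hn
  exact (le_abs_self _).trans hn

theorem ceil_logb_pow_bounds {σ : ℕ} (hσ : 2 ≤ σ) {x a : ℝ} (hx : 1 ≤ x) (ha : 0 ≤ a) :
    x ^ a ≤ (σ : ℝ) ^ ⌈a * Real.logb σ x⌉₊ ∧ (σ : ℝ) ^ ⌈a * Real.logb σ x⌉₊ ≤ σ * x ^ a := by
  have hσ' : (1 : ℝ) < σ := by exact_mod_cast hσ
  have hx0 : 0 < x := by linarith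
  have hxa : (σ : ℝ) ^ (a * Real.logb σ x) = x ^ a := by
    rw [mul_comm, Real.rpow_mul (by positivity), Real.rpow_logb (by positivity) hσ'.ne' hx0]
  have h0 : 0 ≤ a * Real.logb σ x := mul_nonneg ha (Real.logb_nonneg hσ' hx)
  rw [← hxa, ← Real.rpow_natCast]
  refine ⟨Real.rpow_le_rpow_of_exponent_le hσ'.le (Nat.le_ceil _), ?_⟩
  calc _ ≤ (σ : ℝ) ^ (a * Real.logb σ x + 1) :=
        Real.rpow_le_rpow_of_exponent_le hσ'.le (Nat.ceil_lt_add_one h0).le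
    _ = _ := by rw [Real.rpow_add (by positivity), Real.rpow_one, mul_comm]

/-! ### Choice of parameters and contradiction -/

theorem exponent_le {σ m n u v B G ℓ f : ℕ} (hσ : 2 ≤ σ) (hmn : m ≤ n)
    (hf : σ ^ ℓ ≤ 2 * f) (hcard : f ≤ m * (4 ^ u * (4 ^ u * (4 ^ v * G ^ B)))) :
    ℓ ≤ Nat.log 2 n + 2 + 4 * u + 2 * v + G * B := by
  have h4 : ∀ j, 4 ^ j = 2 ^ (2 * j) := fun j => by rw [pow_mul]; norm_num
  have hn : m ≤ 2 ^ (Nat.log 2 n + 1) :=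
    hmn.trans (Nat.lt_pow_succ_log_self (by norm_num) n).le
  have hG : G ^ B ≤ 2 ^ (G * B) := by
    rw [pow_mul]
    exact Nat.pow_le_pow_left Nat.lt_two_pow_self.le B
  refine (Nat.pow_le_pow_iff_right (a := 2) (by norm_num)).mp ?_
  calc 2 ^ ℓ ≤ σ ^ ℓ := Nat.pow_le_pow_left hσ ℓ
    _ ≤ 2 * f := hf
    _ ≤ 2 * (m * (4 ^ u * (4 ^ u * (4 ^ v * G ^ B)))) := by gcongr
    _ ≤ 2 * (2 ^ (Nat.log 2 n + 1) * (2 ^ (2 * u) * (2 ^ (2 * u) * (2 ^ (2 * v) *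
        2 ^ (G * B))))) := by rw [h4, h4]; gcongr
    _ = _ := by ring

theorem exists_large_encoding {σ : ℕ} (hσ : 2 ≤ σ) {c δ : ℝ} (hc : 0 < c) (hδ : 0 < δ)
    {Γ : Type} [Fintype Γ] (A : WStreamsAlg σ Γ) (ro : Readout) {n b p : ℕ} {C : ℝ}
    (hC : 0 ≤ C)
    (hmem : ∀ s : List (Fin σ), s.length = n → A.UsesMemory s b)
    (hinj : Set.InjOn (fun s => ro.encoding (A.after s p)) {s : List (Fin σ) | s.length = n})
    (hn : 1 ≤ n) (hb : (b : ℝ) + 1 ≤ (n : ℝ) ^ (c + δ / 4)) (hp : (p : ℝ) ≤ (n : ℝ) ^ (δ / 4))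
    (hE : C * (8 * (n : ℝ) ^ (1 - δ) * Real.logb 2 n + σ * (n : ℝ) ^ (1 - 2 * δ)) ≤
      (n : ℝ) ^ (1 - δ / 2))
    (hlog : Real.logb 2 n ≤ (n : ℝ) ^ (c + 3 * δ / 4))
    (hbig : 17 + 4 * ((Fintype.card Γ : ℝ) + 1) < (n : ℝ) ^ (δ / 4))
    (hk : 2 * ((c + 2 * δ) * Real.logb σ n + 1) ≤ (n : ℝ) ^ (c + δ))
    (hℓn : 2 * (n : ℝ) ^ (c + δ) ≤ n) :
    ∃ s : List (Fin σ), s.length = n ∧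
      C * ((n : ℝ) * entropy ⌈(c + 2 * δ) * Real.logb σ n⌉₊ s +
        (σ : ℝ) ^ ⌈(c + 2 * δ) * Real.logb σ n⌉₊ * (n : ℝ) ^ (1 - c - 4 * δ)) <
          encodingBits (ro.encoding (A.after s p)) := by
  by_contra! hcon
  have hx : (1 : ℝ) ≤ n := by exact_mod_cast hn
  have hx0 : (0 : ℝ) < n := by linarith
  set x : ℝ := (n : ℝ) with hxdef
  obtain ⟨hk1, hk2⟩ := ceil_logb_pow_bounds hσ hx (by positivity : 0 ≤ c + 2 * δ)
  have hσ' : (1 : ℝ) < σ := by exact_mod_cast hσ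
  have hklog : 0 ≤ (c + 2 * δ) * Real.logb σ x :=
    mul_nonneg (by positivity) (Real.logb_nonneg hσ' hx)
  have hkc := (Nat.ceil_lt_add_one hklog).le
  set k := ⌈(c + 2 * δ) * Real.logb σ x⌉₊
  have hpow1 : 1 ≤ x ^ (c + δ) := Real.one_le_rpow hx (by positivity)
  have hℓ1 := Nat.le_ceil (x ^ (c + δ))
  have hℓ2 : (⌈x ^ (c + δ)⌉₊ : ℝ) ≤ 2 * x ^ (c + δ) := by
    have := (Nat.ceil_lt_add_one (by positivity : 0 ≤ x ^ (c + δ))).le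
    linarith
  set ℓ := ⌈x ^ (c + δ)⌉₊
  have hℓ0 : 0 < ℓ := Nat.ceil_pos.mpr (by positivity)
  have hℓ0' : (0 : ℝ) < ℓ := by exact_mod_cast hℓ0
  have : NeZero ℓ := ⟨hℓ0.ne'⟩
  have hℓlen : ℓ ≤ n := by
    have : (ℓ : ℝ) ≤ n := hℓ2.trans hℓn
    exact_mod_cast this
  have hkℓ : 2 * k ≤ ℓ := by
    have : (2 * k : ℝ) ≤ ℓ := by linarith
    exact_mod_cast this
  set m := n / ℓ with hmdef
  have hm0 : 0 < m := Nat.div_pos hℓlen hℓ0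
  have hmn : m * ℓ ≤ n := Nat.div_mul_le_self n ℓ
  have hm1 : ((m + 1 : ℕ) : ℝ) * ℓ ≤ 2 * x := by
    have h : (m + 1) * ℓ ≤ 2 * n := by rw [add_mul, one_mul]; omega
    rw [hxdef]
    exact_mod_cast h
  have hm2 : x ≤ 2 * (m * ℓ) := by
    have h1 : n < (m + 1) * ℓ := by
      rw [hmdef, mul_comm]
      exact Nat.lt_mul_div_succ n hℓ0
    have h2 : n ≤ 2 * (m * ℓ) := by
      have := Nat.le_mul_of_pos_left ℓ hm0
      rw [add_mul, one_mul] at h1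
      omega
    rw [hxdef]
    exact_mod_cast h2
  have hB1 := Nat.lt_floor_add_one (2 * ℓ * x ^ (-(δ / 2)))
  have hB2 := Nat.floor_le (by positivity : 0 ≤ 2 * ℓ * x ^ (-(δ / 2)))
  -- The average share `n^(1-δ/2) / m` of a copy is at most `2ℓ n^(-δ/2)`, because `n ≤ 2mℓ`.
  set B := ⌊2 * ℓ * x ^ (-(δ / 2))⌋₊
  have hlog0 : 0 ≤ Real.logb 2 x := Real.logb_nonneg (by norm_num) hx
  have hcard := card_le_of_encodingBits_le hσ A ro hm0 hmn hmem hinj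
    ((Finset.univ : Finset (Fin ℓ → Fin σ)).filter fun r =>
      (collisions r k).card * Fintype.card (Fin σ) ^ k ≤ 2 * ℓ ^ 2)
    (x ^ (1 - δ / 2)) (B := B) ?_ ?_
  rotate_left
  · calc x ^ (1 - δ / 2) = x * x ^ (-(δ / 2)) := by
          rw [sub_eq_add_neg, Real.rpow_add hx0, Real.rpow_one]
      _ ≤ 2 * (m * ℓ) * x ^ (-(δ / 2)) := by gcongr
      _ = m * (2 * ℓ * x ^ (-(δ / 2))) := by ring
      _ < m * (B + 1) := by
          have : (0 : ℝ) < m := by exact_mod_cast hm0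
          gcongr
  · intro r hr
    simp only [Finset.mem_filter, Finset.mem_univ, true_and, Fintype.card_fin] at hr
    refine (hcon _ (length_periodicString r n)).trans (le_trans ?_ hE)
    have hr' : ((collisions r k).card : ℝ) * (σ : ℝ) ^ k ≤ 2 * (ℓ : ℝ) ^ 2 := by
      exact_mod_cast hr
    gcongr C * (?_ + ?_)
    · refine (mul_entropy_periodicString_le r n k hn).trans ?_
      rw [← hmdef]
      gcongr
      have hcol : ((collisions r k).card : ℝ) * x ^ (c + 2 * δ) ≤ 2 * (ℓ : ℝ) ^ 2 :=
        le_trans (by gcongr) hr'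
      have hpos : 0 < x ^ (c + 2 * δ) := by positivity
      refine le_of_mul_le_mul_right ?_ hpos
      refine le_of_mul_le_mul_right ?_ hℓ0'
      push_cast at hm1 ⊢
      calc ((m : ℝ) + 1) * (collisions r k).card * x ^ (c + 2 * δ) * ℓ
          = (((m : ℝ) + 1) * ℓ) * ((collisions r k).card * x ^ (c + 2 * δ)) := by ring
        _ ≤ (2 * x) * (2 * (ℓ : ℝ) ^ 2) := by gcongr
        _ = (4 * x * ℓ) * ℓ := by ring
        _ ≤ (4 * x * (2 * x ^ (c + δ))) * ℓ := by gcongr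
        _ = 8 * x ^ (1 - δ) * x ^ (c + 2 * δ) * ℓ := by
          have : x ^ (1 - δ) * x ^ (c + 2 * δ) = x * x ^ (c + δ) := by
            rw [← Real.rpow_add hx0]
            nth_rewrite 2 [← Real.rpow_one x]
            rw [← Real.rpow_add hx0]
            ring_nf
          linear_combination (-8 * (ℓ : ℝ)) * this
    · calc (σ : ℝ) ^ k * x ^ (1 - c - 4 * δ) ≤ σ * x ^ (c + 2 * δ) * x ^ (1 - c - 4 * δ) := by
            gcongr
        _ = σ * x ^ (1 - 2 * δ) := by
            rw [mul_assoc, ← Real.rpow_add hx0]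
            ring_nf
  have hexp := exponent_le hσ (Nat.div_le_self n ℓ)
    (by simpa using card_few_collisions (α := Fin σ) hkℓ) (by simpa using hcard)
  have hexp' : (ℓ : ℝ) ≤ Nat.log 2 n + 2 + 4 * (((b : ℝ) + 1) * p) + 2 * (((B : ℝ) + 1) * p) +
      ((Fintype.card Γ : ℝ) + 1) * B := by exact_mod_cast hexp
  have hlog' : (Nat.log 2 n : ℝ) ≤ x ^ (c + 3 * δ / 4) := by
    have := Real.natLog_le_logb n 2
    push_cast at this
    exact this.trans hlog
  have hBle : (B : ℝ) ≤ 4 * x ^ (c + δ / 2) := by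
    calc (B : ℝ) ≤ 2 * ℓ * x ^ (-(δ / 2)) := hB2
      _ ≤ 2 * (2 * x ^ (c + δ)) * x ^ (-(δ / 2)) := by gcongr
      _ = 4 * (x ^ (c + δ) * x ^ (-(δ / 2))) := by ring
      _ = 4 * x ^ (c + δ / 2) := by
          rw [← Real.rpow_add hx0]
          ring_nf
  have hone : 1 ≤ x ^ (c + δ / 2) := Real.one_le_rpow hx (by positivity)
  -- All costs are compared with `y`: the constant 17 is `1 + 2 + 4 + 2 * 5`, from the index, the
  -- additive 2, the memory contents and the outputs. The tape adds `4 (|Γ| + 1)`.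
  set y := x ^ (c + 3 * δ / 4) with hy
  have hy1 : 1 ≤ y := Real.one_le_rpow hx (by positivity)
  have hmono : x ^ (c + δ / 2) ≤ y := Real.rpow_le_rpow_of_exponent_le hx (by linarith)
  have t1 : ((b : ℝ) + 1) * p ≤ y := by
    calc _ ≤ x ^ (c + δ / 4) * x ^ (δ / 4) := by gcongr
      _ = x ^ (c + δ / 2) := by rw [← Real.rpow_add hx0]; ring_nf
      _ ≤ y := hmono
  have t2 : ((B : ℝ) + 1) * p ≤ 5 * y := by
    calc _ ≤ (5 * x ^ (c + δ / 2)) * x ^ (δ / 4) := by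
          gcongr
          linarith
      _ = 5 * y := by rw [mul_assoc, ← Real.rpow_add hx0, hy]; ring_nf
  have t3 : ((Fintype.card Γ : ℝ) + 1) * B ≤ ((Fintype.card Γ : ℝ) + 1) * (4 * y) := by
    gcongr
    linarith
  have t4 : x ^ (c + δ) = x ^ (δ / 4) * y := by rw [hy, ← Real.rpow_add hx0]; ring_nf
  have t5 : (17 + 4 * ((Fintype.card Γ : ℝ) + 1)) * y < x ^ (δ / 4) * y := by gcongr
  linarith

theorem eventually_exists_large_encoding {σ : ℕ} (hσ : 2 ≤ σ) {c ε : ℝ} (hε : 0 < ε)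
    (hεc : ε < c) (hcε : c < 1 - ε) {Γ : Type} [Fintype Γ] (A : ℕ → WStreamsAlg σ Γ)
    (ro : Readout) (b p : ℕ → ℕ)
    (hb : (fun n => (b n : ℝ)) =O[atTop] (fun n : ℕ => (n : ℝ) ^ c))
    (hp : ∃ e : ℕ, (fun n => (p n : ℝ)) =O[atTop] (fun n : ℕ => Real.log (n : ℝ) ^ e))
    (hmem : ∀ (n : ℕ) (s : List (Fin σ)), s.length = n → (A n).UsesMemory s (b n))
    (hinj : ∀ n : ℕ, Set.InjOn (fun s => ro.encoding ((A n).after s (p n)))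
      {s : List (Fin σ) | s.length = n}) (C : ℝ) :
    ∀ᶠ n : ℕ in atTop, ∃ s : List (Fin σ), s.length = n ∧
      C * ((n : ℝ) * entropy ⌈(c + ε / 2) * Real.logb σ n⌉₊ s +
        (σ : ℝ) ^ ⌈(c + ε / 2) * Real.logb σ n⌉₊ * (n : ℝ) ^ (1 - c - ε)) <
          encodingBits (ro.encoding ((A n).after s (p n))) := by
  obtain ⟨e, hp⟩ := hp
  obtain ⟨δ, hδ⟩ : ∃ δ, δ = ε / 4 := ⟨_, rfl⟩
  have hε4 : ε = 4 * δ := by linarith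
  subst hε4
  have hδ0 : 0 < δ := by linarith
  have hc : 0 < c := by linarith
  have e1 := eventually_le_rpow_of_isLittleO
    ((hb.trans_isLittleO (isLittleO_natCast_rpow_rpow (by linarith : c < c + δ / 4))).add
      (isLittleO_const_natCast_rpow 1 (by linarith : 0 < c + δ / 4)))
  have e2 := eventually_le_rpow_of_isLittleO
    (hp.trans_isLittleO (isLittleO_natCast_log_pow_rpow e (by linarith : 0 < δ / 4)))
  -- Since `C` may be negative, it is replaced by `max C 0`; this only strengthens the claim.
  have e3 : ∀ᶠ n : ℕ in atTop, max C 0 * (8 * (n : ℝ) ^ (1 - δ) * Real.logb 2 n +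
      σ * (n : ℝ) ^ (1 - 2 * δ)) ≤ (n : ℝ) ^ (1 - δ / 2) := by
    refine eventually_le_rpow_of_isLittleO (IsLittleO.const_mul_left (IsLittleO.add ?_ ?_) _)
    · have h1 := ((isBigO_refl (fun n : ℕ => (n : ℝ) ^ (1 - δ)) atTop).const_mul_left 8).mul_isLittleO
        ((isLittleO_natCast_log_rpow (by linarith : 0 < δ / 2)).const_mul_left (Real.log 2)⁻¹)
      refine h1.congr' (Eventually.of_forall fun n => ?_) ?_
      · simp only [Real.logb]; ring
      · filter_upwards [eventually_gt_atTop 0] with n hn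
        rw [← Real.rpow_add (by exact_mod_cast hn)]
        ring_nf
    · exact (isLittleO_natCast_rpow_rpow (by linarith)).const_mul_left _
  have e4 : ∀ᶠ n : ℕ in atTop, Real.logb 2 n ≤ (n : ℝ) ^ (c + 3 * δ / 4) := by
    refine eventually_le_rpow_of_isLittleO
      (((isLittleO_natCast_log_rpow (by linarith : 0 < c + 3 * δ / 4)).const_mul_left
        (Real.log 2)⁻¹).congr_left fun n => ?_)
    simp only [Real.logb]; ring
  have e5 := eventually_le_rpow_of_isLittleO
    (isLittleO_const_natCast_rpow (17 + 4 * ((Fintype.card Γ : ℝ) + 1) + 1)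
      (by linarith : 0 < δ / 4))
  have e6 : ∀ᶠ n : ℕ in atTop,
      2 * ((c + 2 * δ) * Real.logb σ n + 1) ≤ (n : ℝ) ^ (c + δ) := by
    refine eventually_le_rpow_of_isLittleO
      ((((isLittleO_natCast_log_rpow (by linarith : 0 < c + δ)).const_mul_left
        (2 * (c + 2 * δ) * (Real.log σ)⁻¹)).add
          (isLittleO_const_natCast_rpow 2 (by linarith : 0 < c + δ))).congr_left fun n => ?_)
    simp only [Real.logb]; ring
  have e7 := eventually_le_rpow_of_isLittleO
    ((isLittleO_natCast_rpow_rpow (by linarith : c + δ < 1)).const_mul_left 2)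
  filter_upwards [e1, e2, e3, e4, e5, e6, e7, eventually_ge_atTop 1] with n h1 h2 h3 h4 h5 h6 h7 h8
  rw [Real.rpow_one] at h7
  obtain ⟨s, hs, hlt⟩ := exists_large_encoding hσ hc hδ0 (A n) ro (le_max_right C 0) (hmem n)
    (hinj n) h8 h1 h2 h3 h4 (by linarith) h6 h7
  refine ⟨s, hs, lt_of_le_of_lt ?_ hlt⟩
  rw [show c + 4 * δ / 2 = c + 2 * δ by ring]
  have hent : 0 ≤ entropy ⌈(c + 2 * δ) * Real.logb σ n⌉₊ s := entropy_nonneg _ _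
  gcongr
  exact le_max_left _ _

theorem theorem6 (σ : ℕ) (hσ : 2 ≤ σ) (c ε : ℝ) (hε : 0 < ε) (hεc : ε < c) (hcε : c < 1 - ε) :
    -- Multipass
    (∀ (A : ℕ → MultipassAlg σ) (b p : ℕ → ℕ),
      (fun n => (b n : ℝ)) =O[atTop] (fun n : ℕ => (n : ℝ) ^ c) →
      (∃ e : ℕ, (fun n => (p n : ℝ)) =O[atTop] (fun n : ℕ => Real.log (n : ℝ) ^ e)) →
      (∀ (n : ℕ) (s : List (Fin σ)), s.length = n →
        (A n).toWStreams.HaltsWithin s (p n) ∧ (A n).toWStreams.UsesMemory s (b n)) →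
      (∀ n : ℕ, Set.InjOn (fun s => ((A n).toWStreams.after s (p n)).out)
        {s : List (Fin σ) | s.length = n}) →
      ∀ C : ℝ, ∀ᶠ n : ℕ in atTop, ∃ s : List (Fin σ), s.length = n ∧
        C * ((n : ℝ) * entropy ⌈(c + ε / 2) * Real.logb σ n⌉₊ s +
            (σ : ℝ) ^ ⌈(c + ε / 2) * Real.logb σ n⌉₊ * (n : ℝ) ^ (1 - c - ε)) <
          (((A n).toWStreams.after s (p n)).out.length : ℝ)) ∧
    -- W-Streams
    (∀ (Γ : Type) [Fintype Γ] (A : ℕ → WStreamsAlg σ Γ) (r : Readout) (b p : ℕ → ℕ),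
      (fun n => (b n : ℝ)) =O[atTop] (fun n : ℕ => (n : ℝ) ^ c) →
      (∃ e : ℕ, (fun n => (p n : ℝ)) =O[atTop] (fun n : ℕ => Real.log (n : ℝ) ^ e)) →
      (∀ (n : ℕ) (s : List (Fin σ)), s.length = n →
        (A n).HaltsWithin s (p n) ∧ (A n).UsesMemory s (b n)) →
      (∀ n : ℕ, Set.InjOn (fun s => r.encoding ((A n).after s (p n)))
        {s : List (Fin σ) | s.length = n}) →
      ∀ C : ℝ, ∀ᶠ n : ℕ in atTop, ∃ s : List (Fin σ), s.length = n ∧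
        C * ((n : ℝ) * entropy ⌈(c + ε / 2) * Real.logb σ n⌉₊ s +
            (σ : ℝ) ^ ⌈(c + ε / 2) * Real.logb σ n⌉₊ * (n : ℝ) ^ (1 - c - ε)) <
          encodingBits (r.encoding ((A n).after s (p n)))) := by
  refine ⟨fun A b p hb hp hrun hinj C => ?_, fun Γ _ A r b p hb hp hrun hinj C =>
    eventually_exists_large_encoding hσ hε hεc hcε A r b p hb hp
      (fun n s hs => (hrun n s hs).2) hinj C⟩
  -- Multipass is the special case of an unchanged tape with only the output stream stored.
  have h := eventually_exists_large_encoding hσ hε hεc hcε (fun n => (A n).toWStreams) .output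
    b p hb hp (fun n s hs => (hrun n s hs).2)
    (fun n s hs s' hs' h => hinj n hs hs' (congrArg Prod.fst h)) C
  simpa [Readout.encoding, encodingBits] using h
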